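/- Let $n\in\mathbb N$, let $f\in\mathbb R[x_1,\dots,x_n]$ be a polynomial (not necessarily convex), and let $K\subseteq\mathbb R^n$ be a convex body, i.e. a compact convex set with nonempty interior. For $r\in\mathbb N$ let $\Sigma[x]_r$ be the set of all sums of squares of real polynomials in $x_1,\dots,x_n$ that have degree at most $2r$, and define $$\underline f^{(r)}_K:=\inf\Big\{\int_K h(x)f(x)\,dx \;:\; h\in\Sigma[x]_r,\ \int_K h(x)\,dx=1\Big\},\qquad f_{\min,K}:=\min_{x\in K}f(x).$$ Then there is a constant $c>0$, depending only on $f$ and $K$, such that for every integer $r\ge 1$ $$\underline f^{(2r)}_K-f_{\min,K}\le\frac{c}{r}.$$ Moreover, the inequality holds for every integer $r\ge1$ with $$c=(ne+1)\Big(|f_{\min,K}|+C^1_f\cdot\operatorname{diam}(K)+C^2_f\cdot\operatorname{diam}(K)^2\Big),$$ where $C^1_f=\max_{x\in K}\|\nabla f(x)\|_2$ and $C^2_f=\max_{x\in K}\|\nabla^2 f(x)\|_2$ (Euclidean norm of the gradient, spectral norm of the Hessian), and $\operatorname{diam}$ is the Euclidean diameter. -/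

import Mathlib

open MeasureTheory

noncomputable section

namespace Lasserre

/-- The polynomial function `ℝⁿ → ℝ` of a real polynomial in `n` variables
(`ℝⁿ` with its Euclidean norm). -/
def polyFun {n : ℕ} (f : MvPolynomial (Fin n) ℝ) (x : EuclideanSpace ℝ (Fin n)) : ℝ :=
  MvPolynomial.eval (fun i => x i) f

/-- `Σ[x]_r`: the sums of squares of real polynomials having degree at most `2 * r`. -/
def sosPolys (n r : ℕ) : Set (MvPolynomial (Fin n) ℝ) :=
  {h | IsSumSq h ∧ h.totalDegree ≤ 2 * r}

/-- Lasserre's measure-based upper bound of order `r`: the infimum of `∫_K h f dx` over all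
`h ∈ Σ[x]_r` with `∫_K h dx = 1`. If `K` is compact with nonempty interior, then the set of these
values is nonempty and bounded below, so that `sInf` is the true infimum. -/
def upperBound {n : ℕ} (f : MvPolynomial (Fin n) ℝ) (K : Set (EuclideanSpace ℝ (Fin n)))
    (r : ℕ) : ℝ :=
  sInf {v : ℝ | ∃ h ∈ sosPolys n r,
    (∫ x in K, polyFun h x) = 1 ∧ v = ∫ x in K, (polyFun h x * polyFun f x)}

/-- The minimum of `f` over `K` (attained if `K` is nonempty and compact). -/
def minOn {n : ℕ} (f : MvPolynomial (Fin n) ℝ) (K : Set (EuclideanSpace ℝ (Fin n))) : ℝ :=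
  sInf (polyFun f '' K)

/-- The maximum over `K` of the Euclidean norm of the gradient of `f`. -/
def maxGradNorm {n : ℕ} (f : MvPolynomial (Fin n) ℝ)
    (K : Set (EuclideanSpace ℝ (Fin n))) : ℝ :=
  sSup ((fun x => ‖gradient (polyFun f) x‖) '' K)

/-- The maximum over `K` of the spectral norm (Euclidean operator norm) of the Hessian of `f`,
the Hessian being the derivative of the gradient. -/
def maxHessNorm {n : ℕ} (f : MvPolynomial (Fin n) ℝ)
    (K : Set (EuclideanSpace ℝ (Fin n))) : ℝ :=
  sSup ((fun x => ‖fderiv ℝ (gradient (polyFun f)) x‖) '' K)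

end Lasserre

end

/-! Let `a` minimise `f` on `K`. Taylor expansion at `a` gives f ≤ f(a) + w on `K`, with w a
quadratic polynomial: ⟨∇f(a), x − a⟩ plus the Hessian bound times ‖x − a‖². Optimality on the convex
set makes w ≥ 0 there. As density take the normalised Taylor polynomial of degree 2r of exp,
evaluated at −w/T; it is a sum of squares (`sum_sq_eq_truncated_exp`) of degree at most 4r. For the
exact weight exp(−w/T), shrinking `K` towards `a` shows that w has mean at most nT
(`setIntegral_mul_exp_neg_le`). With M ≥ max w and T = eM/r, truncation adds at most M/r
(`pow_div_factorial_mul_exp_le_inv`), for a total of (ne + 1)M/r. -/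

/-! ### Truncated exponentials as sums of squares -/

open Finset in
theorem sum_choose_mul_choose (r a b : ℕ) (ha : a ≤ r) :
    ∑ m ∈ range (r + 1), a.choose m * b.choose m = (a + b).choose a := by
  rw [Nat.add_choose_eq, Finset.Nat.sum_antidiagonal_eq_sum_range_succ
    (fun i j => a.choose i * b.choose j), ← Finset.sum_range_reflect _ a.succ]
  symm
  refine (Finset.sum_congr rfl fun m hm => ?_).trans
    (Finset.sum_subset (Finset.range_subset_range.2 (Nat.succ_le_succ ha)) fun m _ hm => ?_)
  · have : m ≤ a := by simpa [Nat.lt_succ_iff] using hm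
    have h1 : a.succ - 1 - m = a - m := by omega
    have h2 : a - (a - m) = m := by omega
    rw [h1, h2, Nat.choose_symm this]
  · rw [Nat.choose_eq_zero_of_lt (by simpa using hm), zero_mul]

open Finset in
theorem sum_sum_choose_mul_choose {R : Type*} [CommSemiring R] (r : ℕ) (F : ℕ → R) :
    ∑ i ∈ range (r + 1), ∑ j ∈ range (r + 1), ((r.choose i * r.choose j : ℕ) : R) * F (i + j) =
      ∑ k ∈ range (2 * r + 1), ((2 * r).choose k : R) * F k := by
  rw [← Finset.sum_product', ← Finset.sum_fiberwise_of_maps_to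
    (g := fun p : ℕ × ℕ => p.1 + p.2) (t := range (2 * r + 1))
    (by simp only [mem_product, mem_range]; intro p hp; omega)]
  refine Finset.sum_congr rfl fun k _ => ?_
  rw [two_mul, Nat.add_choose_eq, Nat.cast_sum, Finset.sum_mul]
  refine (Finset.sum_subset (fun p hp => ?_) fun p hp hp' => ?_).trans
    (Finset.sum_congr rfl fun p hp => ?_)
  · simp only [mem_filter] at hp
    exact HasAntidiagonal.mem_antidiagonal.2 hp.2
  · rw [HasAntidiagonal.mem_antidiagonal] at hp
    simp only [mem_filter, mem_product, mem_range, hp, and_true, not_and_or, not_lt] at hp'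
    rcases hp' with h | h <;> simp [Nat.choose_eq_zero_of_lt h]
  · rw [HasAntidiagonal.mem_antidiagonal.1 hp]

open Finset Nat in
/-- An explicit representation of the truncated exponential series of even degree as a sum of
squares. -/
theorem sum_sq_eq_truncated_exp {R : Type*} [CommRing R] (r : ℕ) (s : R) :
    ∑ m ∈ range (r + 1),
        (∑ i ∈ range (r + 1), ((r.choose i * (r - i)! * (r - i).choose m : ℕ) : R) * s ^ i) ^ 2 =
      ∑ k ∈ range (2 * r + 1), ((2 * r).choose k : R) * (((2 * r - k)! : ℕ) * s ^ k) := by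
  rw [← sum_sum_choose_mul_choose]
  simp only [sq, Finset.sum_mul_sum]
  rw [Finset.sum_comm]
  refine Finset.sum_congr rfl fun i hi => ?_
  rw [Finset.sum_comm]
  refine Finset.sum_congr rfl fun j hj => ?_
  have hi' : i ≤ r := by simpa [Nat.lt_succ_iff] using hi
  have hj' : j ≤ r := by simpa [Nat.lt_succ_iff] using hj
  -- Vandermonde's identity writes the Hankel matrix (2r − i − j)! as a Gram matrix, with m indexing
  -- the squares.
  have key : ((2 * r - (i + j))! : ℕ) =
      (r - i)! * (r - j)! * ∑ m ∈ range (r + 1), (r - i).choose m * (r - j).choose m := by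
    rw [sum_choose_mul_choose _ _ _ (Nat.sub_le r i), mul_comm (_ * _),
      ← _root_.mul_assoc, Nat.choose_symm_add, Nat.add_choose_mul_factorial_mul_factorial]
    congr 1; omega
  rw [key]
  push_cast
  simp only [Finset.mul_sum, Finset.sum_mul]
  refine Finset.sum_congr rfl fun m _ => ?_
  ring

open Finset Nat in
theorem sum_choose_mul_factorial_mul_pow (m : ℕ) (s : ℝ) :
    ∑ k ∈ range (m + 1), (m.choose k : ℝ) * (((m - k)! : ℕ) * s ^ k) =
      m ! * ∑ k ∈ range (m + 1), s ^ k / k ! := by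
  rw [Finset.mul_sum]
  refine Finset.sum_congr rfl fun k hk => ?_
  have hk' : k ≤ m := by simpa [Nat.lt_succ_iff] using hk
  rw [← Nat.choose_mul_factorial_mul_factorial hk']
  have := Nat.factorial_ne_zero k
  push_cast
  field_simp

/-! ### Scalar estimates for the truncation error -/

-- The signed remainder of order m + 1 has the one of order m as derivative and vanishes at 0, so
-- both bounds follow by induction and monotonicity.
open Finset Nat in
theorem alternating_exp_remainder_mem (m : ℕ) : ∀ s : ℝ, 0 ≤ s →
    0 ≤ (-1) ^ m * (∑ k ∈ range (m + 1), (-s) ^ k / (k ! : ℝ) - Real.exp (-s)) ∧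
      (-1) ^ m * (∑ k ∈ range (m + 1), (-s) ^ k / (k ! : ℝ) - Real.exp (-s)) ≤
        s ^ (m + 1) / (m + 1)! := by
  have mono : ∀ g g' : ℝ → ℝ, (∀ x, HasDerivAt g (g' x) x) → (∀ x, 0 ≤ x → 0 ≤ g' x) →
      g 0 = 0 → ∀ s, 0 ≤ s → 0 ≤ g s := by
    intro g g' hg hg' h0 s hs
    have := monotoneOn_of_hasDerivWithinAt_nonneg (f' := g') (convex_Ici (0 : ℝ))
      (fun x _ => (hg x).continuousAt.continuousWithinAt)
      (fun x _ => (hg x).hasDerivWithinAt)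
      (fun x hx => hg' x (by rw [interior_Ici] at hx; exact le_of_lt hx))
    rw [← h0]
    exact this Set.self_mem_Ici hs hs
  have dpow : ∀ (k : ℕ) (x : ℝ), HasDerivAt (fun x : ℝ => x ^ (k + 1) / (k + 1)!) (x ^ k / (k ! : ℝ)) x := by
    intro k x
    refine ((hasDerivAt_pow (k + 1) x).div_const _).congr_deriv ?_
    have := Nat.factorial_ne_zero k
    rw [Nat.factorial_succ]
    push_cast
    field_simp
  have dexp : ∀ x : ℝ, HasDerivAt (fun x : ℝ => Real.exp (-x)) (-Real.exp (-x)) x := by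
    intro x
    simpa using (hasDerivAt_neg x).exp
  induction m with
  | zero =>
    intro s hs
    have h1 : Real.exp (-s) ≤ 1 := Real.exp_le_one_iff.2 (by linarith)
    have h2 := Real.add_one_le_exp (-s)
    constructor <;> simp <;> linarith
  | succ m ih =>
    have dsum : ∀ x : ℝ, HasDerivAt
        (fun x : ℝ => (-1) ^ (m + 1) * (∑ k ∈ range (m + 1 + 1), (-x) ^ k / (k ! : ℝ) - Real.exp (-x)))
        ((-1) ^ m * (∑ k ∈ range (m + 1), (-x) ^ k / (k ! : ℝ) - Real.exp (-x))) x := by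
      intro x
      simp_rw [Finset.sum_range_succ' _ (m + 1)]
      have h := HasDerivAt.fun_sum (u := range (m + 1))
        (fun k _ => (dpow k (-x)).comp x (hasDerivAt_neg x))
      refine (((h.add_const ((-x) ^ 0 / (0 ! : ℝ))).sub (dexp x)).const_mul
        ((-1 : ℝ) ^ (m + 1))).congr_deriv ?_
      rw [← Finset.sum_mul]
      ring
    have z : (∑ k ∈ range (m + 1 + 1), (-(0 : ℝ)) ^ k / (k ! : ℝ) - Real.exp (-0)) = 0 := by
      rw [Finset.sum_range_succ']
      simp
    intro s hs
    refine ⟨mono _ _ dsum (fun x hx => (ih x hx).1) (by rw [z, mul_zero]) s hs, ?_⟩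
    have := mono _ _ (fun x => (dpow (m + 1) x).sub (dsum x))
      (fun x hx => sub_nonneg.2 (ih x hx).2) (by simp only [Pi.sub_apply]; rw [z]; simp) s hs
    exact sub_nonneg.1 this

/-- Compares the largest truncation error, at argument r/e, with the smallest weight exp(−r/e). The
first two factors give at most 4⁻ʳ, since (2r)^(2r+1)/(2r+1)! ≤ e^(2r); the last is at most 2ʳ. -/
theorem pow_div_factorial_mul_exp_le_inv {r : ℕ} (hr : 1 ≤ r) :
    (r / Real.exp 1) ^ (2 * r + 1) / (Nat.factorial (2 * r + 1)) * Real.exp (r / Real.exp 1)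
      ≤ 1 / r := by
  have hr0 : (0 : ℝ) < r := by exact_mod_cast hr
  have he : (2 : ℝ) ≤ Real.exp 1 := by have := Real.add_one_le_exp (1 : ℝ); linarith
  have he4 : Real.exp 1 ≤ 4 := by have := Real.exp_one_lt_d9; linarith
  have h1 := Real.pow_div_factorial_le_exp (2 * r : ℝ) (by positivity) (2 * r + 1)
  have h2 : (r / Real.exp 1) ^ (2 * r + 1) / (Nat.factorial (2 * r + 1)) ≤ 1 / 4 ^ r := by
    have e1 : (r / Real.exp 1) ^ (2 * r + 1) / (Nat.factorial (2 * r + 1)) =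
      (2 * r : ℝ) ^ (2 * r + 1) / (Nat.factorial (2 * r + 1)) / (2 * Real.exp 1) ^ (2 * r + 1) := by
      rw [div_pow, mul_pow, mul_pow]; field_simp
    rw [e1, div_le_div_iff₀ (by positivity) (by positivity)]
    have e2 : (2 * Real.exp 1) ^ (2 * r + 1) = 4 ^ r * Real.exp (2 * r) * (2 * Real.exp 1) := by
      rw [pow_succ, pow_mul, mul_pow, mul_pow, ← Real.exp_nat_mul, ← Real.exp_nat_mul]
      norm_num
      ring_nf
    rw [e2]
    have : (0 : ℝ) < 4 ^ r * Real.exp (2 * r) := by positivity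
    nlinarith [mul_le_mul_of_nonneg_right h1 (by positivity : (0 : ℝ) ≤ 4 ^ r)]
  have h3 : Real.exp (r / Real.exp 1) ≤ 2 ^ r := by
    have : Real.exp (1 / 2) ≤ 2 := by
      have h : Real.exp (1 / 2) ^ 2 = Real.exp 1 := by rw [← Real.exp_nat_mul]; norm_num
      nlinarith [Real.exp_pos (1 / 2)]
    calc Real.exp (r / Real.exp 1) ≤ Real.exp (r * (1 / 2)) := by
          apply Real.exp_le_exp.2
          rw [div_eq_mul_one_div]
          gcongr
      _ = Real.exp (1 / 2) ^ r := Real.exp_nat_mul _ _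
      _ ≤ 2 ^ r := by gcongr
  have h4 : (r : ℝ) ≤ 2 ^ r := by exact_mod_cast (Nat.lt_two_pow_self (n := r)).le
  calc _ ≤ 1 / 4 ^ r * (2 : ℝ) ^ r := by gcongr
    _ = 1 / 2 ^ r := by
        rw [show (4 : ℝ) = 2 * 2 by norm_num, mul_pow]; field_simp
    _ ≤ 1 / r := by gcongr

/-! ### Boltzmann mean on a convex body -/

/-- For a nonnegative function `v` that is subhomogeneous about `a ∈ K`, the mean of `v`
with respect to the Boltzmann density `exp (-v)` on `K` is at most the dimension. -/
theorem setIntegral_mul_exp_neg_le {n : ℕ} {K : Set (EuclideanSpace ℝ (Fin n))}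
    (hc : IsCompact K) (hK : Convex ℝ K) {a : EuclideanSpace ℝ (Fin n)} (ha : a ∈ K)
    {v : EuclideanSpace ℝ (Fin n) → ℝ} (hv : Continuous v)
    (hstar : ∀ x ∈ K, ∀ l : ℝ, 0 < l → l ≤ 1 → v (a + l • (x - a)) ≤ l * v x) :
    ∫ x in K, v x * Real.exp (-v x) ≤ n * ∫ x in K, Real.exp (-v x) := by
  have hm := hc.measurableSet
  have int : ∀ {F : EuclideanSpace ℝ (Fin n) → ℝ}, Continuous F → IntegrableOn F K :=
    fun hF => hF.continuousOn.integrableOn_compact hc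
  set I := ∫ x in K, Real.exp (-v x) with hI
  set J := ∫ x in K, v x * Real.exp (-v x) with hJ
  -- Compare the integral over `K` with that over a + l(K − a) ⊆ K, whose Jacobian is lⁿ, using
  -- exp((1 − l)v) ≥ 1 + (1 − l)v. Dividing by 1 − l leaves a geometric sum, which tends to n as l →
  -- 1.
  have key : ∀ l : ℝ, 0 < l → l < 1 → l ^ n * J ≤ (∑ i ∈ Finset.range n, l ^ i) * I := by
    intro l hl hl1
    have hsub : (fun x => a + l • (x - a)) '' K ⊆ K := by
      rintro _ ⟨x, hx, rfl⟩
      exact hK.add_smul_sub_mem ha hx ⟨hl.le, hl1.le⟩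
    have hder : ∀ x ∈ K, HasFDerivWithinAt (fun x => a + l • (x - a))
        (l • ContinuousLinearMap.id ℝ (EuclideanSpace ℝ (Fin n))) K x := fun x _ =>
      ((((hasFDerivWithinAt_id x K).sub_const a).const_smul l).const_add a)
    have hinj : Set.InjOn (fun x => a + l • (x - a)) K := by
      intro x _ y _ h
      simpa [hl.ne'] using h
    have hdet : (l • ContinuousLinearMap.id ℝ (EuclideanSpace ℝ (Fin n))).det = l ^ n := by
      simp [ContinuousLinearMap.det]
    have h1 : l ^ n * ∫ x in K, Real.exp (-v (a + l • (x - a))) ≤ I := by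
      have := integral_image_eq_integral_abs_det_fderiv_smul volume hm hder hinj
        (fun x => Real.exp (-v x))
      rw [hdet, abs_of_pos (pow_pos hl n)] at this
      simp only [smul_eq_mul] at this
      rw [integral_const_mul] at this
      rw [← this, hI]
      exact setIntegral_mono_set (int (by fun_prop)) (ae_of_all _ fun x => (Real.exp_pos _).le)
        (LE.le.eventuallyLE hsub)
    have h2 : I + (1 - l) * J ≤ ∫ x in K, Real.exp (-v (a + l • (x - a))) := by
      rw [hI, hJ, ← integral_const_mul, ← integral_add (int (by fun_prop)) (int (by fun_prop))]
      refine setIntegral_mono_on (int (by fun_prop)) (int (by fun_prop)) hm fun x hx => ?_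
      calc Real.exp (-v x) + (1 - l) * (v x * Real.exp (-v x))
          = ((1 - l) * v x + 1) * Real.exp (-v x) := by ring
        _ ≤ Real.exp ((1 - l) * v x) * Real.exp (-v x) := by
            gcongr; exact Real.add_one_le_exp _
        _ = Real.exp (-(l * v x)) := by rw [← Real.exp_add]; congr 1; ring
        _ ≤ _ := Real.exp_le_exp.2 (neg_le_neg (hstar x hx l hl hl1.le))
    have h3 : l ^ n * (I + (1 - l) * J) ≤ I :=
      (mul_le_mul_of_nonneg_left h2 (pow_pos hl n).le).trans h1
    have h4 := geom_sum_mul_neg l n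
    refine le_of_mul_le_mul_left ?_ (sub_pos.2 hl1)
    calc (1 - l) * (l ^ n * J) ≤ (1 - l ^ n) * I := by linarith
      _ = _ := by rw [← h4]; ring
  have lim1 : Filter.Tendsto (fun l : ℝ => l ^ n * J) (nhdsWithin 1 (Set.Iio 1)) (nhds J) := by
    have : Continuous fun l : ℝ => l ^ n * J := by fun_prop
    simpa using (this.tendsto 1).mono_left nhdsWithin_le_nhds
  have lim2 : Filter.Tendsto (fun l : ℝ => (∑ i ∈ Finset.range n, l ^ i) * I)
      (nhdsWithin 1 (Set.Iio 1)) (nhds (n * I)) := by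
    have : Continuous fun l : ℝ => (∑ i ∈ Finset.range n, l ^ i) * I := by fun_prop
    simpa using (this.tendsto 1).mono_left nhdsWithin_le_nhds
  refine le_of_tendsto_of_tendsto lim1 lim2 ?_
  filter_upwards [Ioo_mem_nhdsLT (show (0 : ℝ) < 1 by norm_num)] with l hl
  exact key l hl.1 hl.2

/-! ### Polynomial functions and admissible densities -/

theorem continuous_polyFun {n : ℕ} (f : MvPolynomial (Fin n) ℝ) :
    Continuous (Lasserre.polyFun f) := by
  unfold Lasserre.polyFun
  exact (MvPolynomial.continuous_eval f).comp (by fun_prop)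

theorem contDiff_polyFun {n : ℕ} (f : MvPolynomial (Fin n) ℝ) {m : WithTop ℕ∞} :
    ContDiff ℝ m (Lasserre.polyFun f) := by
  unfold Lasserre.polyFun
  induction f using MvPolynomial.induction_on with
  | C a => simpa using contDiff_const
  | add p q hp hq => simpa using hp.add hq
  | mul_X p i hp => simpa using hp.mul (by fun_prop)

theorem contDiff_gradient_polyFun {n : ℕ} (f : MvPolynomial (Fin n) ℝ) {m : ℕ} :
    ContDiff ℝ m (gradient (Lasserre.polyFun f)) :=
  (InnerProductSpace.toDual ℝ (EuclideanSpace ℝ (Fin n))).symm.contDiff.comp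
    ((contDiff_polyFun f).fderiv_right (m := m) le_rfl)

theorem polyFun_nonneg_of_isSumSq {n : ℕ} {h : MvPolynomial (Fin n) ℝ} (hh : IsSumSq h)
    (x : EuclideanSpace ℝ (Fin n)) : 0 ≤ Lasserre.polyFun h x := by
  unfold Lasserre.polyFun
  induction hh with
  | zero => simp
  | sq_add p _ ih =>
    rw [map_add, map_mul]
    exact add_nonneg (mul_self_nonneg _) ih

/-- The infimum defining the upper bound is at most each of its values. -/
theorem upperBound_le {n r : ℕ} {f h : MvPolynomial (Fin n) ℝ}
    {K : Set (EuclideanSpace ℝ (Fin n))} (hc : IsCompact K) (hh : h ∈ Lasserre.sosPolys n r)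
    (h1 : ∫ x in K, Lasserre.polyFun h x = 1) :
    Lasserre.upperBound f K r ≤ ∫ x in K, Lasserre.polyFun h x * Lasserre.polyFun f x := by
  refine csInf_le ?_ ⟨h, hh, h1, rfl⟩
  obtain ⟨m, hm⟩ := (hc.image (continuous_polyFun f)).bddBelow
  refine ⟨m, ?_⟩
  rintro _ ⟨q, hq, hq1, rfl⟩
  have hcf := continuous_polyFun f
  have hcq := continuous_polyFun q
  calc m = ∫ x in K, Lasserre.polyFun q x * m := by rw [integral_mul_const, hq1, one_mul]
    _ ≤ _ := by
      refine setIntegral_mono_on ((hcq.mul continuous_const).continuousOn.integrableOn_compact hc)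
        ((hcq.mul hcf).continuousOn.integrableOn_compact hc) hc.measurableSet fun x hx => ?_
      exact mul_le_mul_of_nonneg_left (hm ⟨x, hx, rfl⟩) (polyFun_nonneg_of_isSumSq hq.1 x)

open Finset Nat in
/-- A nonnegative multiple of the truncated exponential series of even degree, evaluated at a
polynomial of degree at most two, is a sum of squares. -/
theorem exists_sosPolys_eq_truncated_exp {n r : ℕ} {w : MvPolynomial (Fin n) ℝ}
    (hw : w.totalDegree ≤ 2) {c : ℝ} (hc : 0 ≤ c) (t : ℝ) :
    ∃ h ∈ Lasserre.sosPolys n (2 * r), ∀ x, Lasserre.polyFun h x =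
      c * ∑ k ∈ range (2 * r + 1), (t * Lasserre.polyFun w x) ^ k / (k ! : ℝ) := by
  refine ⟨∑ m ∈ range (r + 1), (MvPolynomial.C (Real.sqrt (c / (2 * r)!)) *
    ∑ i ∈ range (r + 1), MvPolynomial.C ((r.choose i * (r - i)! * (r - i).choose m : ℕ) : ℝ) *
      (MvPolynomial.C t * w) ^ i) ^ 2, ⟨IsSumSq.sum_sq _ _, ?_⟩, fun x => ?_⟩
  · refine MvPolynomial.totalDegree_finsetSum_le fun m _ => ?_
    refine (MvPolynomial.totalDegree_pow _ _).trans (Nat.mul_le_mul_left 2 ?_)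
    refine (MvPolynomial.totalDegree_mul _ _).trans ?_
    rw [MvPolynomial.totalDegree_C, zero_add]
    refine MvPolynomial.totalDegree_finsetSum_le fun i hi => ?_
    refine (MvPolynomial.totalDegree_mul _ _).trans ?_
    rw [MvPolynomial.totalDegree_C, zero_add]
    refine (MvPolynomial.totalDegree_pow _ _).trans ?_
    have h1 := MvPolynomial.totalDegree_mul (MvPolynomial.C t) w
    rw [MvPolynomial.totalDegree_C, zero_add] at h1
    have hi' : i ≤ r := by simpa [Nat.lt_succ_iff] using hi
    calc _ ≤ r * 2 := Nat.mul_le_mul hi' (h1.trans hw)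
      _ = 2 * r := Nat.mul_comm _ _
  · have h0 : ((2 * r)! : ℝ) ≠ 0 := by exact_mod_cast Nat.factorial_ne_zero _
    have h2 := sum_sq_eq_truncated_exp r (t * Lasserre.polyFun w x)
    rw [sum_choose_mul_factorial_mul_pow] at h2
    calc _ = (c / (2 * r)!) * ∑ m ∈ range (r + 1), (∑ i ∈ range (r + 1),
          ((r.choose i * (r - i)! * (r - i).choose m : ℕ) : ℝ) *
            (t * Lasserre.polyFun w x) ^ i) ^ 2 := by
          rw [Finset.mul_sum]
          simp only [Lasserre.polyFun, map_sum, map_pow, map_mul, MvPolynomial.eval_C, mul_pow _ _ 2]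
          rw [Real.sq_sqrt (by positivity)]
      _ = _ := by rw [h2]; field_simp

/-! ### The bound from a quadratic majorant -/

open Finset Nat in
theorem upperBound_le_of_quadratic_majorant {n : ℕ} {f w : MvPolynomial (Fin n) ℝ}
    {K : Set (EuclideanSpace ℝ (Fin n))} (hc : IsCompact K) (hK : Convex ℝ K)
    (hint : (interior K).Nonempty) {a : EuclideanSpace ℝ (Fin n)} (ha : a ∈ K)
    (hw : w.totalDegree ≤ 2)
    (hstar : ∀ x ∈ K, ∀ l : ℝ, 0 < l → l ≤ 1 →
      Lasserre.polyFun w (a + l • (x - a)) ≤ l * Lasserre.polyFun w x)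
    (hw0 : ∀ x ∈ K, 0 ≤ Lasserre.polyFun w x) {m M : ℝ} (hM : 0 < M)
    (hwM : ∀ x ∈ K, Lasserre.polyFun w x ≤ M)
    (hf : ∀ x ∈ K, Lasserre.polyFun f x ≤ m + Lasserre.polyFun w x) {r : ℕ} (hr : 1 ≤ r) :
    Lasserre.upperBound f K (2 * r) - m ≤ (n * Real.exp 1 + 1) * M / r := by
  have hr0 : (0 : ℝ) < r := by exact_mod_cast hr
  have he := Real.exp_pos 1
  have hm := hc.measurableSet
  have int : ∀ {F : EuclideanSpace ℝ (Fin n) → ℝ}, Continuous F → IntegrableOn F K :=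
    fun hF => hF.continuousOn.integrableOn_compact hc
  have cw := continuous_polyFun w
  have cf := continuous_polyFun f
  -- This temperature keeps w/T ≤ r/e on `K`, where truncation is harmless, while nT is still
  -- O(1/r).
  set T : ℝ := Real.exp 1 * M / r with hT
  have hT0 : 0 < T := by positivity
  set v : EuclideanSpace ℝ (Fin n) → ℝ := fun x => T⁻¹ * Lasserre.polyFun w x with hv
  have cv : Continuous v := by fun_prop
  have hTv : ∀ x, Lasserre.polyFun w x = T * v x := fun x => by
    rw [hv]; field_simp
  have hv0 : ∀ x ∈ K, 0 ≤ v x := fun x hx => mul_nonneg (inv_pos.2 hT0).le (hw0 x hx)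
  have hvM : ∀ x ∈ K, v x ≤ r / Real.exp 1 := fun x hx =>
    (mul_le_mul_of_nonneg_left (hwM x hx) (inv_pos.2 hT0).le).trans_eq (by rw [hT]; field_simp)
  set p : EuclideanSpace ℝ (Fin n) → ℝ :=
    fun x => ∑ k ∈ range (2 * r + 1), (-v x) ^ k / (k ! : ℝ) with hp
  have cp : Continuous p := by fun_prop
  set E : ℝ := (r / Real.exp 1) ^ (2 * r + 1) / ((2 * r + 1)! : ℝ) with hE
  have hE0 : 0 ≤ E := by positivity
  -- Even truncation order makes `p` dominate the exponential, so normalising by `Z` instead of `I`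
  -- only helps.
  have hpl : ∀ x ∈ K, Real.exp (-v x) ≤ p x := fun x hx => by
    have := (alternating_exp_remainder_mem (2 * r) (v x) (hv0 x hx)).1
    simpa [pow_mul] using this
  have hpu : ∀ x ∈ K, p x ≤ Real.exp (-v x) + E := fun x hx => by
    have h1 := (alternating_exp_remainder_mem (2 * r) (v x) (hv0 x hx)).2
    have h2 : v x ^ (2 * r + 1) / ((2 * r + 1)! : ℝ) ≤ E := by
      have := hv0 x hx
      have := hvM x hx
      rw [hE]; gcongr
    rw [pow_mul] at h1
    norm_num at h1
    have h3 : p x - Real.exp (-v x) ≤ v x ^ (2 * r + 1) / ((2 * r + 1)! : ℝ) := by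
      simpa [sub_le_iff_le_add] using h1
    linarith
  set I := ∫ x in K, Real.exp (-v x) with hI
  set Z := ∫ x in K, p x with hZ
  set V := volume.real K with hV
  have hVpos : 0 < V := by
    refine ENNReal.toReal_pos ?_ hc.measure_lt_top.ne
    exact (Measure.measure_pos_of_nonempty_interior _ hint).ne'
  -- Lets the uniform error `E`, integrated over `K`, be measured against `I`.
  have hVI : V ≤ Real.exp (r / Real.exp 1) * I := by
    have : V * Real.exp (-(r / Real.exp 1)) ≤ I := by
      rw [hV, hI, ← smul_eq_mul, ← setIntegral_const]
      exact setIntegral_mono_on (int continuous_const) (int (by fun_prop)) hm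
        fun x hx => Real.exp_le_exp.2 (neg_le_neg (hvM x hx))
    rw [Real.exp_neg, ← div_eq_mul_inv, div_le_iff₀ (Real.exp_pos _)] at this
    linarith
  have hI0 : 0 < I := by
    by_contra hneg
    have := mul_nonpos_of_nonneg_of_nonpos (Real.exp_pos (r / Real.exp 1)).le (not_lt.1 hneg)
    linarith
  have hIZ : I ≤ Z := setIntegral_mono_on (int (by fun_prop)) (int cp) hm hpl
  have hZ0 : 0 < Z := hI0.trans_le hIZ
  have hboltz : ∫ x in K, v x * Real.exp (-v x) ≤ n * I :=
    setIntegral_mul_exp_neg_le hc hK ha cv fun x hx l hl hl1 => by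
      have := mul_le_mul_of_nonneg_left (hstar x hx l hl hl1) (inv_pos.2 hT0).le
      calc v (a + l • (x - a)) ≤ _ := this
        _ = _ := by rw [hv]; ring
  have hmain : ∫ x in K, Lasserre.polyFun w x * p x ≤ (n * Real.exp 1 + 1) * M / r * Z := by
    calc ∫ x in K, Lasserre.polyFun w x * p x
        ≤ ∫ x in K, (T * (v x * Real.exp (-v x)) + M * E) := by
          refine setIntegral_mono_on (int (by fun_prop)) (int (by fun_prop)) hm fun x hx => ?_
          calc Lasserre.polyFun w x * p x
              ≤ Lasserre.polyFun w x * (Real.exp (-v x) + E) :=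
                mul_le_mul_of_nonneg_left (hpu x hx) (hw0 x hx)
            _ = T * (v x * Real.exp (-v x)) + Lasserre.polyFun w x * E := by
                rw [mul_add, hTv]; ring
            _ ≤ _ := by
                have := hwM x hx
                gcongr
      _ = T * (∫ x in K, v x * Real.exp (-v x)) + V * (M * E) := by
          rw [integral_add (int (by fun_prop)) (int continuous_const), integral_const_mul,
            setIntegral_const, smul_eq_mul, ← hV]
      _ ≤ T * (n * I) + (Real.exp (r / Real.exp 1) * I) * (M * E) := by gcongr
      _ = T * (n * I) + M * I * (E * Real.exp (r / Real.exp 1)) := by ring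
      _ ≤ T * (n * I) + M * I * (1 / r) := by
          have := mul_le_mul_of_nonneg_left (pow_div_factorial_mul_exp_le_inv hr) (mul_pos hM hI0).le
          linarith
      _ = (n * Real.exp 1 + 1) * M / r * I := by rw [hT]; field_simp
      _ ≤ _ := by gcongr
  obtain ⟨h, hh, hhp⟩ := exists_sosPolys_eq_truncated_exp (r := r) hw (inv_pos.2 hZ0).le (-T⁻¹)
  have hhp' : ∀ x, Lasserre.polyFun h x = Z⁻¹ * p x := fun x => by
    rw [hhp, hp, hv]; simp only [neg_mul]
  have h1 : ∫ x in K, Lasserre.polyFun h x = 1 := by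
    simp only [hhp']
    rw [integral_const_mul, ← hZ, inv_mul_cancel₀ hZ0.ne']
  have h2 := upperBound_le (f := f) hc hh h1
  have h3 : ∫ x in K, Lasserre.polyFun h x * Lasserre.polyFun f x ≤
      ∫ x in K, (m * Lasserre.polyFun h x + Z⁻¹ * (Lasserre.polyFun w x * p x)) := by
    have ch := continuous_polyFun h
    refine setIntegral_mono_on (int (by fun_prop)) (int (by fun_prop)) hm fun x hx => ?_
    calc _ ≤ Lasserre.polyFun h x * (m + Lasserre.polyFun w x) :=
          mul_le_mul_of_nonneg_left (hf x hx) (polyFun_nonneg_of_isSumSq hh.1 x)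
      _ = _ := by rw [mul_add, mul_comm _ m]; congr 1; rw [hhp']; ring
  rw [integral_add (int ((continuous_polyFun h).const_mul m)) (int (by fun_prop)),
    integral_const_mul, integral_const_mul, h1] at h3
  have h4 : Z⁻¹ * ∫ x in K, Lasserre.polyFun w x * p x ≤ (n * Real.exp 1 + 1) * M / r := by
    rw [inv_mul_le_iff₀ hZ0, mul_comm Z]; exact hmain
  linarith

/-! ### The quadratic majorant at a minimiser -/

/-- The polynomial `⟪g, x - a⟫ + c ‖x - a‖²`. -/
noncomputable def quadPoly {n : ℕ} (a g : EuclideanSpace ℝ (Fin n)) (c : ℝ) : MvPolynomial (Fin n) ℝ :=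
  ∑ i, (MvPolynomial.C (g i) * (MvPolynomial.X i - MvPolynomial.C (a i)) +
    MvPolynomial.C c * (MvPolynomial.X i - MvPolynomial.C (a i)) ^ 2)

theorem polyFun_quadPoly {n : ℕ} (a g : EuclideanSpace ℝ (Fin n)) (c : ℝ)
    (x : EuclideanSpace ℝ (Fin n)) :
    Lasserre.polyFun (quadPoly a g c) x = inner ℝ g (x - a) + c * ‖x - a‖ ^ 2 := by
  simp [Lasserre.polyFun, quadPoly, EuclideanSpace.norm_sq_eq, Finset.sum_add_distrib,
    Finset.mul_sum, PiLp.inner_apply, mul_comm]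

theorem totalDegree_quadPoly_le {n : ℕ} (a g : EuclideanSpace ℝ (Fin n)) (c : ℝ) :
    (quadPoly a g c).totalDegree ≤ 2 := by
  have hX : ∀ i, (MvPolynomial.X i - MvPolynomial.C (a i) :
      MvPolynomial (Fin n) ℝ).totalDegree ≤ 1 := fun i => by
    refine (MvPolynomial.totalDegree_sub _ _).trans ?_
    simp
  refine MvPolynomial.totalDegree_finsetSum_le fun i _ => ?_
  refine (MvPolynomial.totalDegree_add _ _).trans (max_le ?_ ?_)
  · refine (MvPolynomial.totalDegree_mul _ _).trans ?_
    have := hX i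
    rw [MvPolynomial.totalDegree_C]; omega
  · refine (MvPolynomial.totalDegree_mul _ _).trans ?_
    have := MvPolynomial.totalDegree_pow (MvPolynomial.X i - MvPolynomial.C (a i)) 2
    have := hX i
    rw [MvPolynomial.totalDegree_C]; omega

theorem norm_gradient_le_maxGradNorm {n : ℕ} (f : MvPolynomial (Fin n) ℝ)
    {K : Set (EuclideanSpace ℝ (Fin n))} (hc : IsCompact K) {x : EuclideanSpace ℝ (Fin n)}
    (hx : x ∈ K) : ‖gradient (Lasserre.polyFun f) x‖ ≤ Lasserre.maxGradNorm f K :=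
  le_csSup (hc.image (contDiff_gradient_polyFun f (m := 0)).continuous.norm).bddAbove ⟨x, hx, rfl⟩

theorem norm_fderiv_gradient_le_maxHessNorm {n : ℕ} (f : MvPolynomial (Fin n) ℝ)
    {K : Set (EuclideanSpace ℝ (Fin n))} (hc : IsCompact K) {x : EuclideanSpace ℝ (Fin n)}
    (hx : x ∈ K) :
    ‖fderiv ℝ (gradient (Lasserre.polyFun f)) x‖ ≤ Lasserre.maxHessNorm f K :=
  le_csSup (hc.image ((contDiff_gradient_polyFun f (m := 1)).continuous_fderiv
    one_ne_zero).norm).bddAbove ⟨x, hx, rfl⟩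

/-- The mean value theorem for `f`, then the Lipschitz bound for its gradient; this route loses
Taylor's factor 1/2. -/
theorem polyFun_le_add_quadPoly {n : ℕ} (f : MvPolynomial (Fin n) ℝ)
    {K : Set (EuclideanSpace ℝ (Fin n))} (hc : IsCompact K) (hK : Convex ℝ K)
    {a x : EuclideanSpace ℝ (Fin n)} (ha : a ∈ K) (hx : x ∈ K) :
    Lasserre.polyFun f x ≤ Lasserre.polyFun f a + Lasserre.polyFun
      (quadPoly a (gradient (Lasserre.polyFun f) a) (Lasserre.maxHessNorm f K)) x := by
  have hd : ∀ y, DifferentiableAt ℝ (Lasserre.polyFun f) y := fun y =>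
    (contDiff_polyFun f (m := 1)).differentiable one_ne_zero y
  have hg := (contDiff_gradient_polyFun f (m := 1)).differentiable one_ne_zero
  obtain ⟨z, hz, hfz⟩ := domain_mvt (fun y _ => (hd y).hasFDerivAt.hasFDerivWithinAt) hK ha hx
  have hzK := hK.segment_subset ha hx hz
  have h1 := hK.norm_image_sub_le_of_norm_fderiv_le (fun y _ => hg y)
    (fun y hy => norm_fderiv_gradient_le_maxHessNorm f hc hy) ha hzK
  have hH0 : 0 ≤ Lasserre.maxHessNorm f K :=
    (norm_nonneg _).trans (norm_fderiv_gradient_le_maxHessNorm f hc ha)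
  have hza : ‖z - a‖ ≤ ‖x - a‖ := by
    have := norm_sub_le_of_mem_segment hz
    simpa using this
  have h2 : fderiv ℝ (Lasserre.polyFun f) z (x - a) =
      inner ℝ (gradient (Lasserre.polyFun f) z) (x - a) := by
    rw [← toDual_gradient, InnerProductSpace.toDual_apply_apply]
  rw [h2] at hfz
  have h3 := real_inner_le_norm
    (gradient (Lasserre.polyFun f) z - gradient (Lasserre.polyFun f) a) (x - a)
  rw [inner_sub_left] at h3
  have h4 : ‖gradient (Lasserre.polyFun f) z - gradient (Lasserre.polyFun f) a‖ * ‖x - a‖ ≤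
      Lasserre.maxHessNorm f K * ‖x - a‖ * ‖x - a‖ := by
    gcongr
    exact h1.trans (by gcongr)
  rw [polyFun_quadPoly]
  nlinarith

theorem upperBound_sub_minOn_le {n : ℕ} (f : MvPolynomial (Fin n) ℝ)
    {K : Set (EuclideanSpace ℝ (Fin n))} (hc : IsCompact K) (hK : Convex ℝ K)
    (hint : (interior K).Nonempty) {M : ℝ} (hM : 0 < M)
    (hM' : Lasserre.maxGradNorm f K * Metric.diam K
      + Lasserre.maxHessNorm f K * Metric.diam K ^ 2 ≤ M) {r : ℕ} (hr : 1 ≤ r) :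
    Lasserre.upperBound f K (2 * r) - Lasserre.minOn f K ≤ (n * Real.exp 1 + 1) * M / r := by
  obtain ⟨a, ha, hmin, hamin⟩ :=
    hc.exists_sInf_image_eq_and_le (hint.mono interior_subset) (continuous_polyFun f).continuousOn
  have hH0 : 0 ≤ Lasserre.maxHessNorm f K :=
    (norm_nonneg _).trans (norm_fderiv_gradient_le_maxHessNorm f hc ha)
  have hG0 : 0 ≤ Lasserre.maxGradNorm f K :=
    (norm_nonneg _).trans (norm_gradient_le_maxGradNorm f hc ha)
  have hopt : ∀ x ∈ K, 0 ≤ inner ℝ (gradient (Lasserre.polyFun f) a) (x - a) := fun x hx => by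
    have hloc : IsLocalMinOn (Lasserre.polyFun f) K a :=
      (show IsMinOn (Lasserre.polyFun f) K a from fun y hy => hamin y hy).localize
    have := hloc.hasFDerivWithinAt_nonneg
      ((contDiff_polyFun f (m := 1)).differentiable one_ne_zero
        a).hasFDerivAt.hasFDerivWithinAt
      (sub_mem_posTangentConeAt_of_segment_subset (hK.segment_subset ha hx))
    rwa [← toDual_gradient, InnerProductSpace.toDual_apply_apply] at this
  refine upperBound_le_of_quadratic_majorant
    (w := quadPoly a (gradient (Lasserre.polyFun f) a) (Lasserre.maxHessNorm f K))
    hc hK hint ha (totalDegree_quadPoly_le _ _ _) ?_ ?_ hM ?_ ?_ hr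
  -- The linear part scales by l and the nonnegative quadratic part by l² ≤ l.
  · intro x hx l hl hl1
    rw [polyFun_quadPoly, polyFun_quadPoly, add_sub_cancel_left, inner_smul_right, norm_smul,
      Real.norm_of_nonneg hl.le]
    have h1 : 0 ≤ Lasserre.maxHessNorm f K * ‖x - a‖ ^ 2 := by positivity
    have h2 : l * l ≤ l := by nlinarith
    nlinarith [mul_le_mul_of_nonneg_right h2 h1]
  · intro x hx
    rw [polyFun_quadPoly]
    have := hopt x hx
    positivity
  · intro x hx
    refine le_trans ?_ hM'
    rw [polyFun_quadPoly]
    have hxa : ‖x - a‖ ≤ Metric.diam K := by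
      rw [← dist_eq_norm]; exact Metric.dist_le_diam_of_mem hc.isBounded hx ha
    have h1 := norm_gradient_le_maxGradNorm f hc ha
    have h2 := real_inner_le_norm (gradient (Lasserre.polyFun f) a) (x - a)
    gcongr
    exact h2.trans (by gcongr)
  · intro x hx
    rw [show Lasserre.minOn f K = Lasserre.polyFun f a from hmin]
    exact polyFun_le_add_quadPoly f hc hK ha hx

theorem mainTheorem4 {n : ℕ} (f : MvPolynomial (Fin n) ℝ)
    (K : ConvexBody (EuclideanSpace ℝ (Fin n)))
    (hK : (interior (K : Set (EuclideanSpace ℝ (Fin n)))).Nonempty) :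
    (∃ c : ℝ, 0 < c ∧ ∀ r : ℕ, 1 ≤ r →
      Lasserre.upperBound f K (2 * r) - Lasserre.minOn f K ≤ c / r) ∧
    (∀ r : ℕ, 1 ≤ r →
      Lasserre.upperBound f K (2 * r) - Lasserre.minOn f K ≤
        ((n : ℝ) * Real.exp 1 + 1) *
          (|Lasserre.minOn f K|
            + Lasserre.maxGradNorm f K * Metric.diam (K : Set (EuclideanSpace ℝ (Fin n)))
            + Lasserre.maxHessNorm f K
                * Metric.diam (K : Set (EuclideanSpace ℝ (Fin n))) ^ 2) / r) := by
  set A : ℝ := |Lasserre.minOn f K|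
    + Lasserre.maxGradNorm f K * Metric.diam (K : Set (EuclideanSpace ℝ (Fin n)))
    + Lasserre.maxHessNorm f K * Metric.diam (K : Set (EuclideanSpace ℝ (Fin n))) ^ 2 with hA
  have habs := abs_nonneg (Lasserre.minOn f K)
  obtain ⟨x, hx⟩ := hK.mono interior_subset
  have hH0 := (norm_nonneg _).trans (norm_fderiv_gradient_le_maxHessNorm f K.isCompact hx)
  have hG0 := (norm_nonneg _).trans (norm_gradient_le_maxGradNorm f K.isCompact hx)
  have hA0 : 0 ≤ A := by
    have := Metric.diam_nonneg (s := (K : Set (EuclideanSpace ℝ (Fin n))))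
    positivity
  -- `A` vanishes for f = 0, whereas the temperature needs a positive `M`; hence A + ε, with ε → 0
  -- for the sharp constant.
  have key : ∀ ε : ℝ, 0 < ε → ∀ r : ℕ, 1 ≤ r →
      Lasserre.upperBound f K (2 * r) - Lasserre.minOn f K ≤
        (n * Real.exp 1 + 1) * (A + ε) / r := fun ε hε r hr =>
    upperBound_sub_minOn_le f K.isCompact K.convex hK (by linarith) (by linarith) hr
  refine ⟨⟨(n * Real.exp 1 + 1) * (A + 1), by positivity, key 1 one_pos⟩, fun r hr => ?_⟩
  have hlim : Filter.Tendsto (fun ε : ℝ => (n * Real.exp 1 + 1) * (A + ε) / r)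
      (nhdsWithin 0 (Set.Ioi 0)) (nhds ((n * Real.exp 1 + 1) * A / r)) := by
    have : Continuous fun ε : ℝ => (n * Real.exp 1 + 1) * (A + ε) / r := by fun_prop
    simpa using (this.tendsto 0).mono_left nhdsWithin_le_nhds
  refine ge_of_tendsto hlim ?_
  filter_upwards [self_mem_nhdsWithin] with ε hε
  exact key ε hε r hr
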